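/- Let $\mathcal G$ be a separable Banach--Lie group (a group that is a smooth manifold modelled on a real Banach space, with smooth multiplication and inversion) with identity $e$ and its Borel $\sigma$-algebra, and let $(\Omega,\mathcal F,\mathbb P)$ be a complete probability space. Let $(\mathcal F^s_t)_{0\le s\le t<\infty}$ be an additive filtration satisfying the usual hypotheses: each $\mathcal F^s_t\subseteq\mathcal F$ is a $\sigma$-algebra; for all $s\le t\le u\le v$, $\mathcal F^s_t$ and $\mathcal F^u_v$ are independent and $\mathcal F^t_u\subseteq\mathcal F^s_v$; for all $s\le t$, $\bigcap_{u>t}\mathcal F^s_u=\mathcal F^s_t$ and $\mathcal F^s_t$ contains all $\mathbb P$-null sets. A family $x=(x^s_t)_{0\le s\le t<\infty}$ of maps $\Omega\to\mathcal G$ is called a multiplicative process with respect to $(\mathcal F^s_t)_{s\le t}$ if 1. $x^s_t$ is $\mathcal F^s_t$-measurable for all $s\le t$; 2. for all $s\le t\le u$, almost surely $x^s_s=e$ and $x^s_tx^t_u=x^s_u$; 3. $x$ is stochastically continuous: for all $s\le t$ and every open $U\ni e$, $\mathbb P\big((x^s_t)^{-1}x^{s'}_{t'}\in U\big)\to1$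 as $(s',t')\to(s,t)$ with $0\le s'\le t'$. Theorem (Regularization of multiplicative processes). Every $\mathcal G$-valued multiplicative process $x$ with respect to $(\mathcal F^s_t)_{s\le t}$ has a modification $\bar x=(\bar x^s_t)_{s\le t}$ (that is, $\bar x^s_t=x^s_t$ almost surely for all $s\le t$) such that 1. $\bar x$ is càdlàg in both arguments simultaneously: for every $\omega\in\Omega$ and all $s\le t$, $\bar x^{s'}_{t'}(\omega)\to\bar x^s_t(\omega)$ as $(s',t')\to(s,t)$ with $s'\ge s$, $t'\ge t$, and the limit of $\bar x^{s'}_{t'}(\omega)$ as $(s',t')\to(s,t)$ exists in $\mathcal G$ within each of the three regions $\{s'<s,\,t'<t\}$, $\{s'<s,\,t'\ge t\}$, $\{s'\ge s,\,t'<t\}$ (always with $0\le s'\le t'$; a region with no points near $(s,t)$ imposes no condition); 2. $\bar x$ is again a multiplicative process with respect to $(\mathcal F^s_t)_{s\le t}$; 3. for all $\omega\in\Omega$ and $s\le t\le u$, $\bar x^s_s(\omega)=e$ and $\bar x^s_u(\omega)=\bar x^s_t(\omega)\,\bar x^t_u(\omega)$. -/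

import Mathlib

open MeasureTheory ProbabilityTheory Filter Topology
open scoped NNReal Manifold

namespace MultProc

/-- An additive filtration `(F s t)`, `0 ≤ s ≤ t < ∞`, of sub-`σ`-algebras, satisfying the usual
hypotheses. Only the values `F s t` with `s ≤ t` matter. -/
structure IsAdditiveFiltration {Ω : Type*} {mΩ : MeasurableSpace Ω} (μ : Measure Ω)
    (F : ℝ≥0 → ℝ≥0 → MeasurableSpace Ω) : Prop where
  /-- every `F s t` is a sub-`σ`-algebra of the ambient one -/
  le : ∀ s t, s ≤ t → F s t ≤ mΩ
  /-- `F s t` and `F u v` are independent for `s ≤ t ≤ u ≤ v` -/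
  indep : ∀ s t u v, s ≤ t → t ≤ u → u ≤ v → Indep (F s t) (F u v) μ
  /-- `F t u ⊆ F s v` for `s ≤ t ≤ u ≤ v` -/
  mono : ∀ s t u v, s ≤ t → t ≤ u → u ≤ v → F t u ≤ F s v
  /-- right-continuity: the intersection of `F s u` over `u > t` is `F s t` -/
  rightCont : ∀ s t, s ≤ t → (⨅ u : Set.Ioi t, F s u) = F s t
  /-- completeness: every null set belongs to every `F s t` -/
  complete : ∀ s t, s ≤ t → ∀ A : Set Ω, μ A = 0 → MeasurableSet[F s t] A

/-- Stochastic continuity of a two-parameter process `(x s t)`, `s ≤ t`, in the pair `(s, t)`: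
`P((x s t)⁻¹ * x s' t' ∈ U) → 1` as `(s', t') → (s, t)` within the index set, for every open
neighbourhood `U` of the identity. -/
def StochContAt {Ω : Type*} [MeasurableSpace Ω] {G : Type*} [Group G] [TopologicalSpace G]
    (μ : Measure Ω) (x : ℝ≥0 → ℝ≥0 → Ω → G) (s t : ℝ≥0) : Prop :=
  ∀ U : Set G, IsOpen U → (1 : G) ∈ U →
    Tendsto (fun p : ℝ≥0 × ℝ≥0 => μ {ω | (x s t ω)⁻¹ * x p.1 p.2 ω ∈ U})
      (𝓝[{p : ℝ≥0 × ℝ≥0 | p.1 ≤ p.2}] (s, t)) (𝓝 1)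

/-- A multiplicative process `(x s t)`, `0 ≤ s ≤ t < ∞`, with respect to `(F s t)`.
Only the values `x s t` with `s ≤ t` matter. -/
structure IsMultiplicativeProcess {Ω : Type*} [MeasurableSpace Ω] {G : Type*} [Group G]
    [TopologicalSpace G] [MeasurableSpace G] (μ : Measure Ω)
    (F : ℝ≥0 → ℝ≥0 → MeasurableSpace Ω) (x : ℝ≥0 → ℝ≥0 → Ω → G) : Prop where
  adapted : ∀ s t, s ≤ t → Measurable[F s t] (x s t)
  diag : ∀ s, ∀ᵐ ω ∂μ, x s s ω = 1
  mul : ∀ s t u, s ≤ t → t ≤ u → ∀ᵐ ω ∂μ, x s t ω * x t u ω = x s u ω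
  stochCont : ∀ s t, s ≤ t → StochContAt μ x s t

/-- `y` is a modification of the two-parameter process `x`. -/
def IsModification {Ω : Type*} [MeasurableSpace Ω] {G : Type*} (μ : Measure Ω)
    (y x : ℝ≥0 → ℝ≥0 → Ω → G) : Prop :=
  ∀ s t, s ≤ t → ∀ᵐ ω ∂μ, y s t ω = x s t ω

/-- A two-parameter path `(f s t)`, `s ≤ t`, is càdlàg in both arguments simultaneously: at every
`(s, t)` of the index set it is jointly right-continuous, and the joint limit in each of the other
three quadrants exists. Limits are taken inside the index set; over an empty set of approach
points (for instance `s' < s` when `s = 0`) the condition is void. -/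
structure IsCadlagBoth {G : Type*} [TopologicalSpace G] (f : ℝ≥0 → ℝ≥0 → G) : Prop where
  right_right : ∀ s t, s ≤ t →
    Tendsto (fun p : ℝ≥0 × ℝ≥0 => f p.1 p.2)
      (𝓝[{p : ℝ≥0 × ℝ≥0 | p.1 ≤ p.2 ∧ s ≤ p.1 ∧ t ≤ p.2}] (s, t)) (𝓝 (f s t))
  left_left : ∀ s t, s ≤ t → ∃ l : G,
    Tendsto (fun p : ℝ≥0 × ℝ≥0 => f p.1 p.2)
      (𝓝[{p : ℝ≥0 × ℝ≥0 | p.1 ≤ p.2 ∧ p.1 < s ∧ p.2 < t}] (s, t)) (𝓝 l)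
  left_right : ∀ s t, s ≤ t → ∃ l : G,
    Tendsto (fun p : ℝ≥0 × ℝ≥0 => f p.1 p.2)
      (𝓝[{p : ℝ≥0 × ℝ≥0 | p.1 ≤ p.2 ∧ p.1 < s ∧ t ≤ p.2}] (s, t)) (𝓝 l)
  right_left : ∀ s t, s ≤ t → ∃ l : G,
    Tendsto (fun p : ℝ≥0 × ℝ≥0 => f p.1 p.2)
      (𝓝[{p : ℝ≥0 × ℝ≥0 | p.1 ≤ p.2 ∧ s ≤ p.1 ∧ p.2 < t}] (s, t)) (𝓝 l)

end MultProc

/-!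
Since `x s t = (x 0 s)⁻¹ * x 0 t` almost surely, it suffices to find a càdlàg modification `Y` of
the one-parameter process `x 0 t`. The increments `(Y s)⁻¹ * Y t` are then càdlàg in both arguments
and satisfy the algebraic relations for every `ω`, and they inherit adaptedness from `x` because
every `F s t` contains the null sets.

To find `Y`, fix a countable dense set `D` of times. If, up to a small probability, the increments
over subintervals of `[a, b]` lie in a neighbourhood `V` of the identity, then by independence and
Ottaviani's inequality the path `t ↦ x 0 t` exits `V / V` along finitely many points of `[a, b]` at
least `n` times (restarting after each exit) with probability at most `2⁻¹ ^ n`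
(`measure_manyExits_le`). This bound does not depend on the finite set of points, so almost every
path has only finitely many oscillations of a given size on `D ∩ [a, b]`
(`ae_exists_not_hasOscillations`). By stochastic continuity countably many such intervals cover the
time axis (`ae_isLocallyRegulatedOn`), so along `D` the path is left Cauchy on either side of every
time.

A left Cauchy filter in a Banach-Lie group converges, because the multiplication is Lipschitz in
the chart at the identity (`isLeftComplete_of_lieGroup`); for a general completely metrizable group
this step can fail. Hence the right limits of `x 0` along `D` exist and form a càdlàg path
(`IsLocallyRegulatedOn.exists_isCadlag`). At a fixed time the right limit is `x 0 t` almost surely,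
by stochastic continuity again (`ae_eq_of_tendsto_right`).
-/

namespace MultProc

/-- A filter on a group is left Cauchy if it contains sets whose left quotients `g⁻¹ * h` are
arbitrarily close to the identity. -/
def IsLeftCauchy {G : Type*} [Group G] [TopologicalSpace G] (l : Filter G) : Prop :=
  ∀ U ∈ 𝓝 (1 : G), ∃ S ∈ l, ∀ g ∈ S, ∀ h ∈ S, g⁻¹ * h ∈ U

/-- A group is left complete if every nontrivial left Cauchy filter converges. -/
def IsLeftComplete (G : Type*) [Group G] [TopologicalSpace G] : Prop :=
  ∀ l : Filter G, l.NeBot → IsLeftCauchy l → ∃ g, l ≤ 𝓝 g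

/-! ### Left completeness of Banach-Lie groups -/

section LieGroup

variable (E : Type*) [NormedAddCommGroup E] [NormedSpace ℝ E]
  {G : Type*} [Group G] [TopologicalSpace G] [ChartedSpace E G]

/-- Since multiplication is `C¹`, it is Lipschitz in the chart at the identity, so that for `g`,
`h` near the identity the distance of `h` to `g` in the chart is bounded by that of `g⁻¹ * h` to
the identity. -/
theorem exists_dist_chart_le [LieGroup 𝓘(ℝ, E) 1 G] :
    ∃ K : ℝ≥0, ∃ U ∈ 𝓝 (1 : G), ∀ g ∈ U, ∀ h ∈ U, g⁻¹ * h ∈ U →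
      dist (extChartAt 𝓘(ℝ, E) (1 : G) h) (extChartAt 𝓘(ℝ, E) (1 : G) g) ≤
        K * dist (extChartAt 𝓘(ℝ, E) (1 : G) (g⁻¹ * h)) (extChartAt 𝓘(ℝ, E) (1 : G) 1) := by
  have : IsManifold 𝓘(ℝ, E) 1 G := (inferInstance : ContMDiffMul 𝓘(ℝ, E) 1 G).toIsManifold
  set φ := extChartAt 𝓘(ℝ, E) (1 : G) with hφ
  have h1 : φ.symm (φ 1) = 1 := extChartAt_to_inv (I := 𝓘(ℝ, E)) (1 : G)
  have hsymm : ContMDiffAt 𝓘(ℝ, E) 𝓘(ℝ, E) 1 φ.symm (φ 1) :=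
    (contMDiffOn_extChartAt_symm (1 : G)).contMDiffAt (extChartAt_target_mem_nhds (1 : G))
  have hF : ContDiffAt ℝ 1 (fun p : E × E => φ (φ.symm p.1 * φ.symm p.2)) (φ 1, φ 1) := by
    rw [← contMDiffAt_iff_contDiffAt]
    have hfst : ContMDiffAt 𝓘(ℝ, E × E) 𝓘(ℝ, E) 1 (fun p : E × E => φ.symm p.1) (φ 1, φ 1) :=
      ContMDiffAt.comp (x := ((φ 1, φ 1) : E × E)) (g := φ.symm) (f := Prod.fst) hsymm
        contDiff_fst.contMDiff.contMDiffAt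
    have hsnd : ContMDiffAt 𝓘(ℝ, E × E) 𝓘(ℝ, E) 1 (fun p : E × E => φ.symm p.2) (φ 1, φ 1) :=
      ContMDiffAt.comp (x := ((φ 1, φ 1) : E × E)) (g := φ.symm) (f := Prod.snd) hsymm
        contDiff_snd.contMDiff.contMDiffAt
    have hmul := hfst.mul hsnd
    have hφ1 : ContMDiffAt 𝓘(ℝ, E) 𝓘(ℝ, E) 1 φ (φ.symm (φ 1) * φ.symm (φ 1)) := by
      rw [h1, one_mul]; exact contMDiffAt_extChartAt
    exact ContMDiffAt.comp (x := ((φ 1, φ 1) : E × E)) (g := φ)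
      (f := fun p : E × E => φ.symm p.1 * φ.symm p.2) hφ1 hmul
  obtain ⟨K, s, hs, hLip⟩ := hF.exists_lipschitzOnWith
  obtain ⟨A, hA, B, hB, hAB⟩ := mem_nhds_prod_iff.1 hs
  have hcont : Tendsto φ (𝓝 1) (𝓝 (φ 1)) := continuousAt_extChartAt (1 : G)
  refine ⟨K, φ ⁻¹' A ∩ φ ⁻¹' B ∩ φ.source, inter_mem (inter_mem (hcont hA) (hcont hB))
    (extChartAt_source_mem_nhds (1 : G)), ?_⟩
  rintro g ⟨⟨hgA, -⟩, hgs⟩ h ⟨-, hhs⟩ ⟨⟨-, hkB⟩, hks⟩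
  have key := hLip.dist_le_mul (φ g, φ (g⁻¹ * h)) (hAB ⟨hgA, hkB⟩) (φ g, φ 1)
    (hAB ⟨hgA, mem_of_mem_nhds hB⟩)
  simpa [φ.left_inv hgs, φ.left_inv hks, h1, Prod.dist_eq] using key

/-- A Lie group modelled on a Banach space is left complete: after a translation a left Cauchy
filter lives in a chart, where it is a Cauchy filter of the Banach space. -/
theorem isLeftComplete_of_lieGroup [CompleteSpace E] [LieGroup 𝓘(ℝ, E) 1 G] :
    IsLeftComplete G := by
  intro l hl hc
  have : IsTopologicalGroup G := topologicalGroup_of_lieGroup 𝓘(ℝ, E) 1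
  obtain ⟨K, U, hU, hK⟩ := exists_dist_chart_le E (G := G)
  set φ := extChartAt 𝓘(ℝ, E) (1 : G) with hφ
  have hcont : Tendsto φ (𝓝 1) (𝓝 (φ 1)) := continuousAt_extChartAt (1 : G)
  obtain ⟨r, hr, hball⟩ := Metric.nhds_basis_closedBall.mem_iff.1
    (extChartAt_target_mem_nhds (I := 𝓘(ℝ, E)) (1 : G))
  obtain ⟨S, hS, hSU⟩ := hc (U ∩ φ ⁻¹' Metric.closedBall (φ 1) r ∩ φ.source)
    (inter_mem (inter_mem hU (hcont (Metric.closedBall_mem_nhds _ hr)))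
      (extChartAt_source_mem_nhds (1 : G)))
  obtain ⟨g₀, hg₀⟩ := hl.nonempty_of_mem hS
  have hcauchy : Cauchy (map (fun h => φ (g₀⁻¹ * h)) l) := by
    refine Metric.cauchy_iff.2 ⟨inferInstance, fun ε hε => ?_⟩
    have hW : {k : G | K * dist (φ k) (φ 1) < ε} ∈ 𝓝 (1 : G) := by
      have : Tendsto (fun k => K * dist (φ k) (φ 1)) (𝓝 (1 : G)) (𝓝 (K * dist (φ 1) (φ 1))) :=
        (hcont.dist tendsto_const_nhds).const_mul _
      rw [dist_self, mul_zero] at this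
      exact this.eventually (gt_mem_nhds hε)
    obtain ⟨S', hS', hSW⟩ := hc _ hW
    refine ⟨_, image_mem_map (inter_mem hS hS'), ?_⟩
    rintro _ ⟨h, ⟨hh, hh'⟩, rfl⟩ _ ⟨g, ⟨hg, hg'⟩, rfl⟩
    have hgh : (g₀⁻¹ * g)⁻¹ * (g₀⁻¹ * h) = g⁻¹ * h := by group
    have key := hK _ (hSU g₀ hg₀ g hg).1.1 _ (hSU g₀ hg₀ h hh).1.1
      (by rw [hgh]; exact (hSU g hg h hh).1.1)
    rw [hgh] at key
    exact key.trans_lt (hSW g hg' h hh')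
  obtain ⟨v, hv⟩ := CompleteSpace.complete hcauchy
  have hvr : v ∈ Metric.closedBall (φ 1) r :=
    Metric.isClosed_closedBall.mem_of_tendsto (f := fun h => φ (g₀⁻¹ * h)) (b := l) hv
      (by filter_upwards [hS] with h hh using (hSU g₀ hg₀ h hh).1.2)
  have hsymm : Tendsto φ.symm (𝓝 v) (𝓝 (φ.symm v)) :=
    (continuousOn_extChartAt_symm (I := 𝓘(ℝ, E)) (1 : G)).continuousAt
      ((isOpen_extChartAt_target (1 : G)).mem_nhds (hball hvr))
  have hlim : Tendsto (fun h => g₀⁻¹ * h) l (𝓝 (φ.symm v)) := by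
    have hv' : Tendsto (fun h => φ (g₀⁻¹ * h)) l (𝓝 v) := hv
    refine (hsymm.comp hv').congr' ?_
    filter_upwards [hS] with h hh
    exact φ.left_inv (hSU g₀ hg₀ h hh).2
  refine ⟨g₀ * φ.symm v, ?_⟩
  have := hlim.const_mul g₀
  simpa [Tendsto] using this

end LieGroup

/-! ### Oscillations and one-sided limits of paths -/

theorem nhdsWithin_inter_Ioi_neBot {D : Set ℝ≥0} (hD : Dense D) (t : ℝ≥0) :
    (𝓝[D ∩ Set.Ioi t] t).NeBot := by
  rw [← mem_closure_iff_nhdsWithin_neBot, Set.inter_comm]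
  refine closure_minimal (hD.open_subset_closure_inter isOpen_Ioi) isClosed_closure ?_
  rw [closure_Ioi]
  exact Set.self_mem_Ici

theorem nhdsWithin_inter_Iio_neBot {D : Set ℝ≥0} (hD : Dense D) {t : ℝ≥0} (ht : 0 < t) :
    (𝓝[D ∩ Set.Iio t] t).NeBot := by
  rw [← mem_closure_iff_nhdsWithin_neBot, Set.inter_comm]
  refine closure_minimal (hD.open_subset_closure_inter isOpen_Iio) isClosed_closure ?_
  rw [closure_Iio' (a := t) ⟨0, ht⟩]
  exact Set.self_mem_Iic

/-- One-sided limits along a dense set are inherited by the path of right limits. -/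
theorem tendsto_of_right_limits {X : Type*} [TopologicalSpace X] [RegularSpace X] {D : Set ℝ≥0}
    (hD : Dense D) {f g : ℝ≥0 → X} (hg : ∀ t, Tendsto f (𝓝[D ∩ Set.Ioi t] t) (𝓝 (g t)))
    {t : ℝ≥0} {O : Set ℝ≥0} (hO : IsOpen O)
    {l : X} (h : Tendsto f (𝓝[D ∩ O] t) (𝓝 l)) : Tendsto g (𝓝[O] t) (𝓝 l) := by
  refine (closed_nhds_basis l).tendsto_right_iff.2 fun C ⟨hC, hCc⟩ => ?_
  obtain ⟨V, hV, htV, hVC⟩ := mem_nhdsWithin.1 (h hC)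
  filter_upwards [mem_nhdsWithin_of_mem_nhds (hV.mem_nhds htV), self_mem_nhdsWithin] with s hsV hsO
  have := nhdsWithin_inter_Ioi_neBot hD s
  refine hCc.mem_of_tendsto (hg s) ?_
  filter_upwards [mem_nhdsWithin_of_mem_nhds ((hV.inter hO).mem_nhds ⟨hsV, hsO⟩),
    self_mem_nhdsWithin] with u hu hu'
  exact hVC ⟨hu.1, hu'.1, hu.2⟩

section Paths

variable {G : Type*} [Group G]

/-- `HasOscillations f S U n s`: the path `f` has `n` successive increments `(f u)⁻¹ * f v` outside
`U`, over intervals `[u, v]` with end points in `S` that do not overlap and lie to the right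
of `s`. -/
def HasOscillations (f : ℝ≥0 → G) (S : Set ℝ≥0) (U : Set G) : ℕ → ℝ≥0 → Prop
  | 0, _ => True
  | n + 1, s => ∃ u ∈ S, ∃ v ∈ S, s ≤ u ∧ u < v ∧ (f u)⁻¹ * f v ∉ U ∧ HasOscillations f S U n v

theorem HasOscillations.mono_left {f : ℝ≥0 → G} {S : Set ℝ≥0} {U : Set G} {n : ℕ} {s s' : ℝ≥0}
    (h : HasOscillations f S U n s) (hs : s' ≤ s) : HasOscillations f S U n s' := by
  cases n with
  | zero => trivial
  | succ n =>
    obtain ⟨u, hu, v, hv, hsu, h⟩ := h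
    exact ⟨u, hu, v, hv, hs.trans hsu, h⟩

theorem HasOscillations.mono_set {f : ℝ≥0 → G} {S S' : Set ℝ≥0} {U : Set G} (hS : S ⊆ S') {n : ℕ}
    {s : ℝ≥0} (h : HasOscillations f S U n s) : HasOscillations f S' U n s := by
  induction n generalizing s with
  | zero => trivial
  | succ n ih =>
    obtain ⟨u, hu, v, hv, hsu, huv, hU, h⟩ := h
    exact ⟨u, hS hu, v, hS hv, hsu, huv, hU, ih h⟩

theorem HasOscillations.anti_size {f : ℝ≥0 → G} {S : Set ℝ≥0} {U U' : Set G}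
    (hU : U ⊆ U') {n : ℕ} {s : ℝ≥0} (h : HasOscillations f S U' n s) : HasOscillations f S U n s := by
  induction n generalizing s with
  | zero => trivial
  | succ n ih =>
    obtain ⟨u, hu, v, hv, hsu, huv, hUuv, h⟩ := h
    exact ⟨u, hu, v, hv, hsu, huv, fun hmem => hUuv (hU hmem), ih h⟩

/-- A given number of oscillations only involves finitely many points. -/
theorem HasOscillations.exists_of_iUnion {ι : Type*} [SemilatticeSup ι] [Nonempty ι]
    {f : ℝ≥0 → G} {S : ι → Set ℝ≥0} (hS : Monotone S) {U : Set G} {n : ℕ} {s : ℝ≥0}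
    (h : HasOscillations f (⋃ i, S i) U n s) : ∃ i, HasOscillations f (S i) U n s := by
  induction n generalizing s with
  | zero => exact ⟨Classical.arbitrary ι, trivial⟩
  | succ n ih =>
    obtain ⟨u, hu, v, hv, hsu, huv, hU, h⟩ := h
    obtain ⟨i, hi⟩ := Set.mem_iUnion.1 hu
    obtain ⟨j, hj⟩ := Set.mem_iUnion.1 hv
    obtain ⟨k, hk⟩ := ih h
    exact ⟨i ⊔ j ⊔ k, u, hS (le_sup_left.trans le_sup_left) hi, v,
      hS (le_sup_right.trans le_sup_left) hj, hsu, huv, hU, hk.mono_set (hS le_sup_right)⟩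

variable [TopologicalSpace G]

/-- The path `f`, restricted to `D`, has locally only finitely many oscillations of any
given size. -/
def IsLocallyRegulatedOn (f : ℝ≥0 → G) (D : Set ℝ≥0) : Prop :=
  ∀ U ∈ 𝓝 (1 : G), ∀ t : ℝ≥0, ∃ a b : ℝ≥0, Set.Icc a b ∈ 𝓝 t ∧
    ∃ n, ¬ HasOscillations f (D ∩ Set.Icc a b) U n a

/-- If the increments over `D ∩ Ioi t` did not become small near `t`, disjoint
intervals with a large increment could be chosen one after the other, decreasing to `t`. -/
theorem IsLocallyRegulatedOn.eventually_right {f : ℝ≥0 → G} {D : Set ℝ≥0}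
    (hf : IsLocallyRegulatedOn f D) (t : ℝ≥0) {U : Set G} (hU : U ∈ 𝓝 (1 : G)) :
    ∃ S ∈ 𝓝[D ∩ Set.Ioi t] t, ∀ u ∈ S, ∀ v ∈ S, u < v → (f u)⁻¹ * f v ∈ U := by
  obtain ⟨a, b, hab, n, hn⟩ := hf U hU t
  by_contra! hcon
  refine hn (HasOscillations.mono_left ?_ (mem_of_mem_nhds hab).1 (s := t))
  have key : ∀ m, ∃ w > t, HasOscillations f (D ∩ Set.Icc a b) U m w := by
    intro m
    induction m with
    | zero => exact ⟨t + 1, lt_add_one t, trivial⟩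
    | succ m ih =>
      obtain ⟨w, hw, hm⟩ := ih
      obtain ⟨u, hu, v, hv, huv, hUuv⟩ := hcon (D ∩ Set.Ioi t ∩ (Set.Icc a b ∩ Set.Iio w))
        (inter_mem self_mem_nhdsWithin
          (mem_nhdsWithin_of_mem_nhds (inter_mem hab (Iio_mem_nhds hw))))
      exact ⟨u, hu.1.2, u, ⟨hu.1.1, hu.2.1⟩, v, ⟨hv.1.1, hv.2.1⟩, le_rfl, huv, hUuv,
        hm.mono_left (le_of_lt hv.2.2)⟩
  obtain ⟨w, hw, h⟩ := key n
  exact h.mono_left hw.le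

/-- If the increments over `D ∩ Iio t` did not become small near `t`, disjoint
intervals with a large increment could be chosen one after the other, increasing to `t`. -/
theorem IsLocallyRegulatedOn.eventually_left {f : ℝ≥0 → G} {D : Set ℝ≥0}
    (hf : IsLocallyRegulatedOn f D) (t : ℝ≥0) {U : Set G} (hU : U ∈ 𝓝 (1 : G)) :
    ∃ S ∈ 𝓝[D ∩ Set.Iio t] t, ∀ u ∈ S, ∀ v ∈ S, u < v → (f u)⁻¹ * f v ∈ U := by
  obtain ⟨a, b, hab, n, hn⟩ := hf U hU t
  by_contra! hcon
  have key : ∀ m, ∀ w, w < t → HasOscillations f (D ∩ Set.Icc a b) U m w := by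
    intro m
    induction m with
    | zero => exact fun w _ => trivial
    | succ m ih =>
      intro w hw
      obtain ⟨u, hu, v, hv, huv, hUuv⟩ := hcon (D ∩ Set.Iio t ∩ (Set.Icc a b ∩ Set.Ioi w))
        (inter_mem self_mem_nhdsWithin
          (mem_nhdsWithin_of_mem_nhds (inter_mem hab (Ioi_mem_nhds hw))))
      exact ⟨u, ⟨hu.1.1, hu.2.1⟩, v, ⟨hv.1.1, hv.2.1⟩, le_of_lt hu.2.2, huv, hUuv, ih v hv.1.2⟩
  obtain ⟨u, hu, -⟩ := hcon (D ∩ Set.Iio t ∩ Set.Icc a b)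
    (inter_mem self_mem_nhdsWithin (mem_nhdsWithin_of_mem_nhds hab))
  exact hn ((key n u hu.1.2).mono_left hu.2.1)

/-- In a left complete group, a path with small forward increments along a filter converges. -/
theorem IsLeftComplete.exists_tendsto [IsTopologicalGroup G] (hG : IsLeftComplete G)
    {f : ℝ≥0 → G} {l : Filter ℝ≥0} (hl : l.NeBot)
    (h : ∀ U ∈ 𝓝 (1 : G), ∃ S ∈ l, ∀ u ∈ S, ∀ v ∈ S, u < v → (f u)⁻¹ * f v ∈ U) :
    ∃ g, Tendsto f l (𝓝 g) := by
  refine hG (map f l) inferInstance fun U hU => ?_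
  obtain ⟨S, hS, hSU⟩ := h (U ∩ U⁻¹) (inter_mem hU (inv_mem_nhds_one G hU))
  refine ⟨f '' S, image_mem_map hS, ?_⟩
  rintro _ ⟨u, hu, rfl⟩ _ ⟨v, hv, rfl⟩
  rcases lt_trichotomy u v with huv | rfl | huv
  · exact (hSU u hu v hv huv).1
  · simpa using mem_of_mem_nhds hU
  · simpa using (hSU v hv u hu huv).2

/-- A path is càdlàg if it is right-continuous with left limits. -/
structure IsCadlag (f : ℝ≥0 → G) : Prop where
  right : ∀ t, Tendsto f (𝓝[≥] t) (𝓝 (f t))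
  left : ∀ t, ∃ l, Tendsto f (𝓝[<] t) (𝓝 l)

/-- A path with locally finitely many oscillations along a dense set has a càdlàg path of
right limits. -/
theorem IsLocallyRegulatedOn.exists_isCadlag [IsTopologicalGroup G] (hG : IsLeftComplete G)
    {D : Set ℝ≥0} (hD : Dense D) {f : ℝ≥0 → G} (hf : IsLocallyRegulatedOn f D) :
    ∃ g : ℝ≥0 → G, IsCadlag g ∧ ∀ t, Tendsto f (𝓝[D ∩ Set.Ioi t] t) (𝓝 (g t)) := by
  choose g hg using fun t => hG.exists_tendsto (nhdsWithin_inter_Ioi_neBot hD t)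
    fun U hU => hf.eventually_right t hU
  refine ⟨g, ⟨fun t => ?_, fun t => ?_⟩, hg⟩
  · exact continuousWithinAt_Ioi_iff_Ici.1 (tendsto_of_right_limits hD hg isOpen_Ioi (hg t))
  · rcases eq_zero_or_pos t with rfl | ht
    · exact ⟨1, by simp⟩
    · obtain ⟨l, hl⟩ := hG.exists_tendsto (nhdsWithin_inter_Iio_neBot hD ht)
        fun U hU => hf.eventually_left t hU
      exact ⟨l, tendsto_of_right_limits hD hg isOpen_Iio hl⟩

theorem tendsto_inv_mul_nhdsWithin_prod [IsTopologicalGroup G] {f : ℝ≥0 → G} {A B : Set ℝ≥0}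
    {s t : ℝ≥0} {g h : G} (hg : Tendsto f (𝓝[A] s) (𝓝 g)) (hh : Tendsto f (𝓝[B] t) (𝓝 h))
    {R : Set (ℝ≥0 × ℝ≥0)} (hR : R ⊆ A ×ˢ B) :
    Tendsto (fun p : ℝ≥0 × ℝ≥0 => (f p.1)⁻¹ * f p.2) (𝓝[R] (s, t)) (𝓝 (g⁻¹ * h)) := by
  have hle : 𝓝[R] (s, t) ≤ 𝓝[A] s ×ˢ 𝓝[B] t := by
    rw [← nhdsWithin_prod_eq]; exact nhdsWithin_mono _ hR
  exact ((hg.comp (tendsto_fst.mono_left hle)).inv).mul (hh.comp (tendsto_snd.mono_left hle))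

/-- The increments of a càdlàg path are càdlàg in both arguments simultaneously. -/
theorem IsCadlag.isCadlagBoth [IsTopologicalGroup G] {f : ℝ≥0 → G} (hf : IsCadlag f) :
    IsCadlagBoth (fun s t => (f s)⁻¹ * f t) where
  right_right s t _ := tendsto_inv_mul_nhdsWithin_prod (hf.right s) (hf.right t) fun _ hp => hp.2
  left_left s t _ :=
    let ⟨_, hl⟩ := hf.left s
    let ⟨_, hl'⟩ := hf.left t
    ⟨_, tendsto_inv_mul_nhdsWithin_prod hl hl' fun _ hp => hp.2⟩
  left_right s t _ :=
    let ⟨_, hl⟩ := hf.left s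
    ⟨_, tendsto_inv_mul_nhdsWithin_prod hl (hf.right t) fun _ hp => hp.2⟩
  right_left s t _ :=
    let ⟨_, hl'⟩ := hf.left t
    ⟨_, tendsto_inv_mul_nhdsWithin_prod (hf.right s) hl' fun _ hp => hp.2⟩

end Paths

/-! ### Exits of a multiplicative process along a finite set of times -/

section Exits

open scoped Pointwise ENNReal

variable {Ω : Type*} {G : Type*}

/-- The event that `t` is the first point of `M` to the right of `s` at which the increment
`x s t` lies outside `W`. -/
def firstExit (x : ℝ≥0 → ℝ≥0 → Ω → G) (M : Finset ℝ≥0) (W : Set G) (s t : ℝ≥0) : Set Ω :=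
  {ω | x s t ω ∉ W ∧ ∀ u ∈ M, s < u → u < t → x s u ω ∈ W}

/-- The event that, starting at `s` and restarting after every exit, the increments along `M`
exit `W` at least `n` times. -/
def manyExits (x : ℝ≥0 → ℝ≥0 → Ω → G) (M : Finset ℝ≥0) (W : Set G) : ℕ → ℝ≥0 → Set Ω
  | 0, _ => Set.univ
  | n + 1, s => ⋃ t ∈ M.filter (s < ·), firstExit x M W s t ∩ manyExits x M W n t

theorem pairwiseDisjoint_firstExit (x : ℝ≥0 → ℝ≥0 → Ω → G) (M : Finset ℝ≥0) (W : Set G)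
    (s : ℝ≥0) : (↑(M.filter (s < ·)) : Set ℝ≥0).PairwiseDisjoint (firstExit x M W s) := by
  have key : ∀ t ∈ M.filter (s < ·), ∀ t', t < t' → ∀ ω, ω ∈ firstExit x M W s t →
      ω ∉ firstExit x M W s t' := by
    intro t ht t' htt' ω hω hω'
    rw [Finset.mem_filter] at ht
    exact hω.1 (hω'.2 t ht.1 ht.2 htt')
  intro t ht t' ht' hne
  refine Set.disjoint_left.2 fun ω hω hω' => ?_
  rcases hne.lt_or_gt with h | h
  · exact key t ht t' h ω hω hω'
  · exact key t' ht' t h ω hω' hω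

/-- If an increment `x s t` is outside `W`, there is a first one. -/
theorem exists_firstExit {x : ℝ≥0 → ℝ≥0 → Ω → G} {M : Finset ℝ≥0} {W : Set G} {s t : ℝ≥0}
    (ht : t ∈ M) (hst : s < t) {ω : Ω} (h : x s t ω ∉ W) :
    ∃ u ∈ M.filter (s < ·), u ≤ t ∧ ω ∈ firstExit x M W s u := by
  classical
  have hne : (M.filter fun u => s < u ∧ x s u ω ∉ W).Nonempty := ⟨t, by simp [ht, hst, h]⟩
  have hmem := Finset.min'_mem _ hne
  rw [Finset.mem_filter] at hmem
  refine ⟨_, Finset.mem_filter.2 ⟨hmem.1, hmem.2.1⟩, Finset.min'_le _ _ (by simp [ht, hst, h]),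
    hmem.2.2, fun u hu hsu hlt => ?_⟩
  by_contra hW
  exact absurd hlt (not_lt.2 (Finset.min'_le _ _ (by simp [hu, hsu, hW])))

/-- An increment outside `W⁻¹ * W` forces an exit from `W` before its right end point, so that
every family of oscillations is dominated by successive exits. -/
theorem mem_manyExits_of_hasOscillations [Group G] {x : ℝ≥0 → ℝ≥0 → Ω → G} {M : Finset ℝ≥0}
    {W : Set G} (hW : (1 : G) ∈ W) {ω : Ω} {f : ℝ≥0 → G} {n : ℕ} {s s' : ℝ≥0}
    (hs' : s' ≤ s) (hx : ∀ u ∈ insert s' M, ∀ v ∈ M, u ≤ v → x u v ω = (f u)⁻¹ * f v)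
    (h : HasOscillations f M (W⁻¹ * W) n s) : ω ∈ manyExits x M W n s' := by
  induction n generalizing s s' with
  | zero => trivial
  | succ n ih =>
    obtain ⟨u, hu, v, hv, hsu, huv, hU, h⟩ := h
    have hs'u := hs'.trans hsu
    have hxu := hx s' (Finset.mem_insert_self _ _) u hu hs'u
    have hxv := hx s' (Finset.mem_insert_self _ _) v hv (hs'u.trans huv.le)
    -- If neither `x s' u` nor `x s' v` left `W`, the increment from `u` to `v` would be in
    -- `W⁻¹ * W`.
    have hexit : ∃ w ∈ M.filter (s' < ·), w ≤ v ∧ ω ∈ firstExit x M W s' w := by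
      by_cases h1 : x s' u ω ∈ W
      · refine exists_firstExit hv (hs'u.trans_lt huv) fun h2 => hU ?_
        refine ⟨(x s' u ω)⁻¹, Set.inv_mem_inv.2 h1, x s' v ω, h2, ?_⟩
        simp only [hxu, hxv]
        group
      · have hlt : s' < u := by
          refine hs'u.lt_of_ne ?_
          rintro rfl
          exact h1 (by simpa [hxu] using hW)
        obtain ⟨w, hw, hwu, hwx⟩ := exists_firstExit (x := x) hu hlt h1
        exact ⟨w, hw, hwu.trans huv.le, hwx⟩
    obtain ⟨w, hw, hwv, hwx⟩ := hexit
    refine Set.mem_biUnion hw ⟨hwx, ih hwv ?_ h⟩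
    intro p hp q hq hpq
    refine hx p (Finset.mem_insert_of_mem ?_) q hq hpq
    rcases Finset.mem_insert.1 hp with rfl | hp
    · exact (Finset.mem_filter.1 hw).1
    · exact hp

variable [Group G] [TopologicalSpace G] [MeasurableSpace G]
  {mΩ : MeasurableSpace Ω} {μ : Measure Ω} {F : ℝ≥0 → ℝ≥0 → MeasurableSpace Ω}
  {x : ℝ≥0 → ℝ≥0 → Ω → G}

theorem measurableSet_firstExit (hF : IsAdditiveFiltration μ F)
    (hx : IsMultiplicativeProcess μ F x) (M : Finset ℝ≥0) {W : Set G} (hW : MeasurableSet W)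
    {s t : ℝ≥0} (hst : s ≤ t) : MeasurableSet[F s t] (firstExit x M W s t) := by
  have h : firstExit x M W s t =
      (x s t ⁻¹' W)ᶜ ∩ ⋂ u ∈ M.filter (fun u => s < u ∧ u < t), x s u ⁻¹' W := by
    ext ω
    simp [firstExit]
  rw [h]
  refine MeasurableSet.inter (hx.adapted s t hst hW).compl
    (Finset.measurableSet_biInter _ fun u hu => ?_)
  rw [Finset.mem_filter] at hu
  exact hF.mono s s u t le_rfl hu.2.1.le hu.2.2.le _ (hx.adapted s u hu.2.1.le hW)

theorem measurableSet_manyExits (hF : IsAdditiveFiltration μ F)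
    (hx : IsMultiplicativeProcess μ F x) {M : Finset ℝ≥0} {b : ℝ≥0} (hM : ∀ t ∈ M, t ≤ b)
    {W : Set G} (hW : MeasurableSet W) (n : ℕ) {s : ℝ≥0} (hsb : s ≤ b) :
    MeasurableSet[F s b] (manyExits x M W n s) := by
  induction n generalizing s with
  | zero => exact MeasurableSet.univ
  | succ n ih =>
    refine Finset.measurableSet_biUnion _ fun t ht => ?_
    rw [Finset.mem_filter] at ht
    have htb := hM t ht.1
    exact MeasurableSet.inter
      (hF.mono s s t b le_rfl ht.2.le htb _ (measurableSet_firstExit hF hx M hW ht.2.le))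
      (hF.mono s t b b ht.2.le htb le_rfl _ (ih htb))

/-- Ottaviani's maximal inequality: if `x s b` and the remaining increments `x t b` lie in `V`
with probability at least `3 / 4`, then the increments `x s t` exit `V / V` with probability at
most `1 / 2`. Indeed `x s b` is outside `V` if `x s t` is outside `V / V` and the independent
`x t b` is in `V`. -/
theorem sum_measure_firstExit_le [IsTopologicalGroup G] [BorelSpace G] [IsProbabilityMeasure μ]
    (hF : IsAdditiveFiltration μ F) (hx : IsMultiplicativeProcess μ F x) {M : Finset ℝ≥0}
    {b : ℝ≥0} (hM : ∀ t ∈ M, t ≤ b) {V : Set G} (hV : IsOpen V) {s : ℝ≥0}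
    (hsV : μ {ω | x s b ω ∉ V} ≤ 4⁻¹) (hMV : ∀ t ∈ M, μ {ω | x t b ω ∉ V} ≤ 4⁻¹) :
    ∑ t ∈ M.filter (s < ·), μ (firstExit x M (V / V) s t) ≤ 2⁻¹ := by
  have hVV : MeasurableSet (V / V) := (hV.div_right).measurableSet
  have hmeas : ∀ t ∈ M.filter (s < ·), MeasurableSet (firstExit x M (V / V) s t) := by
    intro t ht
    have hst := (Finset.mem_filter.1 ht).2.le
    exact hF.le s t hst _ (measurableSet_firstExit hF hx M hVV hst)
  have hmeas' : ∀ t ≤ b, MeasurableSet (x t b ⁻¹' V) := fun t htb =>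
    hF.le t b htb _ (hx.adapted t b htb hV.measurableSet)
  have hhalf : ∀ t ∈ M, 2⁻¹ ≤ μ (x t b ⁻¹' V) := by
    intro t ht
    have h1 : μ (x t b ⁻¹' V) = 1 - μ {ω | x t b ω ∉ V} := by
      have := prob_compl_eq_one_sub (μ := μ) (hmeas' t (hM t ht)).compl
      rwa [compl_compl] at this
    rw [h1]
    calc (2⁻¹ : ℝ≥0∞) = 1 - 2⁻¹ := ENNReal.one_sub_inv_two.symm
      _ ≤ 1 - 4⁻¹ := tsub_le_tsub_left (ENNReal.inv_le_inv.2 (by norm_num)) _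
      _ ≤ 1 - μ {ω | x t b ω ∉ V} := tsub_le_tsub_left (hMV t ht) _
  have hprod : (∑ t ∈ M.filter (s < ·), μ (firstExit x M (V / V) s t)) * 2⁻¹ ≤ 4⁻¹ := by
    calc (∑ t ∈ M.filter (s < ·), μ (firstExit x M (V / V) s t)) * 2⁻¹
        ≤ ∑ t ∈ M.filter (s < ·), μ (firstExit x M (V / V) s t ∩ x t b ⁻¹' V) := by
          rw [Finset.sum_mul]
          refine Finset.sum_le_sum fun t ht => ?_
          obtain ⟨htM, hst⟩ := Finset.mem_filter.1 ht
          have htb := hM t htM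
          rw [(Indep_iff _ _ μ).1 (hF.indep s t t b hst.le le_rfl htb) _ _
            (measurableSet_firstExit hF hx M hVV hst.le)
            (hx.adapted t b htb hV.measurableSet)]
          gcongr
          exact hhalf t htM
      _ = μ (⋃ t ∈ M.filter (s < ·), firstExit x M (V / V) s t ∩ x t b ⁻¹' V) := by
          refine (measure_biUnion_finset ?_ fun t ht =>
            (hmeas t ht).inter (hmeas' t (hM t (Finset.mem_filter.1 ht).1))).symm
          exact (pairwiseDisjoint_firstExit x M (V / V) s).mono fun t => Set.inter_subset_left
      _ ≤ μ {ω | x s b ω ∉ V} := by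
          refine measure_mono_ae ?_
          have hmul : ∀ᵐ ω ∂μ, ∀ t ∈ M.filter (s < ·), x s t ω * x t b ω = x s b ω := by
            refine (Finset.eventually_all _).2 fun t ht => ?_
            obtain ⟨htM, hst⟩ := Finset.mem_filter.1 ht
            exact hx.mul s t b hst.le (hM t htM)
          filter_upwards [hmul] with ω hω hmem
          obtain ⟨t, ht, hexit, htV⟩ := Set.mem_iUnion₂.1 hmem
          intro hsV
          refine hexit.1 ⟨x s b ω, hsV, x t b ω, htV, ?_⟩
          simp only [← hω t ht, mul_div_cancel_right]
      _ ≤ 4⁻¹ := hsV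
  calc ∑ t ∈ M.filter (s < ·), μ (firstExit x M (V / V) s t)
      = (∑ t ∈ M.filter (s < ·), μ (firstExit x M (V / V) s t)) * 2⁻¹ * 2 := by
        rw [mul_assoc, ENNReal.inv_mul_cancel (by simp) (by simp), mul_one]
    _ ≤ 4⁻¹ * 2 := by gcongr
    _ = 2⁻¹ := by
        rw [show (4 : ℝ≥0∞) = 2 * 2 by norm_num, ENNReal.mul_inv (by simp) (by simp), mul_assoc,
          ENNReal.inv_mul_cancel (by simp) (by simp), mul_one]

/-- By independence, every further exit costs another factor `1 / 2`. -/
theorem measure_manyExits_le [IsTopologicalGroup G] [BorelSpace G] [IsProbabilityMeasure μ]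
    (hF : IsAdditiveFiltration μ F) (hx : IsMultiplicativeProcess μ F x) {M : Finset ℝ≥0}
    {b : ℝ≥0} (hM : ∀ t ∈ M, t ≤ b) {V : Set G} (hV : IsOpen V)
    (hMV : ∀ t ∈ M, μ {ω | x t b ω ∉ V} ≤ 4⁻¹) (n : ℕ) {s : ℝ≥0} (hsb : s ≤ b)
    (hsV : μ {ω | x s b ω ∉ V} ≤ 4⁻¹) :
    μ (manyExits x M (V / V) n s) ≤ 2⁻¹ ^ n := by
  have hVV : MeasurableSet (V / V) := (hV.div_right).measurableSet
  induction n generalizing s with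
  | zero => simpa using prob_le_one
  | succ n ih =>
    calc μ (manyExits x M (V / V) (n + 1) s)
        ≤ ∑ t ∈ M.filter (s < ·),
            μ (firstExit x M (V / V) s t ∩ manyExits x M (V / V) n t) :=
          measure_biUnion_finset_le _ _
      _ ≤ ∑ t ∈ M.filter (s < ·), μ (firstExit x M (V / V) s t) * 2⁻¹ ^ n := by
          refine Finset.sum_le_sum fun t ht => ?_
          obtain ⟨htM, hst⟩ := Finset.mem_filter.1 ht
          have htb := hM t htM
          rw [(Indep_iff _ _ μ).1 (hF.indep s t t b hst.le le_rfl htb) _ _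
            (measurableSet_firstExit hF hx M hVV hst.le)
            (measurableSet_manyExits hF hx hM hVV n htb)]
          gcongr
          exact ih htb (hMV t htM)
      _ ≤ 2⁻¹ * 2⁻¹ ^ n := by
          rw [← Finset.sum_mul]
          gcongr
          exact sum_measure_firstExit_le hF hx hM hV hsV hMV
      _ = 2⁻¹ ^ (n + 1) := (pow_succ' _ _).symm

end Exits

/-! ### Càdlàg modification of the one-parameter process -/

section Regularity

open scoped Pointwise ENNReal

variable {Ω : Type*} {G : Type*} [Group G] [TopologicalSpace G] [MeasurableSpace G]
  {mΩ : MeasurableSpace Ω} {μ : Measure Ω} {F : ℝ≥0 → ℝ≥0 → MeasurableSpace Ω}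
  {x : ℝ≥0 → ℝ≥0 → Ω → G}

theorem IsMultiplicativeProcess.ae_eq_inv_mul (hx : IsMultiplicativeProcess μ F x) {s t : ℝ≥0}
    (hst : s ≤ t) : ∀ᵐ ω ∂μ, x s t ω = (x 0 s ω)⁻¹ * x 0 t ω := by
  filter_upwards [hx.mul 0 s t zero_le hst] with ω hω
  rw [← hω, inv_mul_cancel_left]

variable [BorelSpace G] [IsProbabilityMeasure μ]

/-- Increments over short intervals are small in probability. -/
theorem tendsto_measure_increment_notMem (hF : IsAdditiveFiltration μ F)
    (hx : IsMultiplicativeProcess μ F x) (t : ℝ≥0) {V : Set G} (hV : IsOpen V)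
    (h1 : (1 : G) ∈ V) :
    Tendsto (fun p : ℝ≥0 × ℝ≥0 => μ {ω | x p.1 p.2 ω ∉ V})
      (𝓝[{p : ℝ≥0 × ℝ≥0 | p.1 ≤ p.2}] (t, t)) (𝓝 0) := by
  have h := ENNReal.Tendsto.sub (tendsto_const_nhds (x := (1 : ℝ≥0∞)))
    (hx.stochCont t t le_rfl V hV h1) (Or.inl ENNReal.one_ne_top)
  rw [tsub_self] at h
  refine h.congr' ?_
  filter_upwards [self_mem_nhdsWithin] with p hp
  have hmeas : MeasurableSet (x p.1 p.2 ⁻¹' V) :=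
    hF.le _ _ hp _ (hx.adapted _ _ hp hV.measurableSet)
  have heq : μ {ω | (x t t ω)⁻¹ * x p.1 p.2 ω ∈ V} = μ (x p.1 p.2 ⁻¹' V) := by
    refine measure_congr (eventuallyEq_set.2 ?_)
    filter_upwards [hx.diag t] with ω hω
    simp [hω]
  rw [heq, ← prob_compl_eq_one_sub hmeas]
  rfl

variable [IsTopologicalGroup G]

/-- On an interval whose increments up to the right end point are small with probability at
least `3 / 4`, almost every path has only finitely many oscillations. -/
theorem ae_exists_not_hasOscillations (hF : IsAdditiveFiltration μ F)
    (hx : IsMultiplicativeProcess μ F x) {D : Set ℝ≥0} (hD : D.Countable) {a b : ℝ≥0}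
    (hab : a ≤ b) {V : Set G} (hV : IsOpen V) (h1 : (1 : G) ∈ V)
    (hVab : ∀ t ∈ Set.Icc a b, μ {ω | x t b ω ∉ V} ≤ 4⁻¹) :
    ∀ᵐ ω ∂μ, ∃ n,
      ¬ HasOscillations (fun t => x 0 t ω) (D ∩ Set.Icc a b) ((V / V)⁻¹ * (V / V)) n a := by
  set S := D ∩ Set.Icc a b with hS
  have hSc : S.Countable := hD.mono Set.inter_subset_left
  have : Countable S := hSc.to_subtype
  have hmul : ∀ᵐ ω ∂μ, ∀ u ∈ insert a S, ∀ v ∈ S, u ≤ v →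
      x u v ω = (x 0 u ω)⁻¹ * x 0 v ω := by
    refine (ae_ball_iff (hSc.insert a)).2 fun u _ => (ae_ball_iff hSc).2 fun v _ => ?_
    exact Filter.eventually_imp_distrib_left.2 fun huv => hx.ae_eq_inv_mul huv
  -- The finite subsets of `S` form a countable directed family with union `S`.
  let M : Finset S → Finset ℝ≥0 := fun i => i.map (Function.Embedding.subtype _)
  have hMS : ∀ i, ∀ t ∈ M i, t ∈ S := by
    intro i t ht
    obtain ⟨u, -, rfl⟩ := Finset.mem_map.1 ht
    exact u.2
  have hM : Monotone fun i => (M i : Set ℝ≥0) := fun i j hij =>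
    Finset.coe_subset.2 (Finset.map_subset_map.2 hij)
  have hUM : ⋃ i, (M i : Set ℝ≥0) = S := by
    refine Set.Subset.antisymm (Set.iUnion_subset fun i t ht => hMS i t ht) fun t ht => ?_
    exact Set.mem_iUnion.2 ⟨{⟨t, ht⟩}, by simp [M]⟩
  have hbound : ∀ n, μ {ω | HasOscillations (fun t => x 0 t ω) S ((V / V)⁻¹ * (V / V)) n a} ≤
      2⁻¹ ^ n := by
    intro n
    calc μ {ω | HasOscillations (fun t => x 0 t ω) S ((V / V)⁻¹ * (V / V)) n a}
        ≤ μ (⋃ i, {ω | HasOscillations (fun t => x 0 t ω) (M i) ((V / V)⁻¹ * (V / V)) n a}) := by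
          refine measure_mono fun ω hω => Set.mem_iUnion.2 ?_
          rw [Set.mem_ofPred_eq, ← hUM] at hω
          exact hω.exists_of_iUnion hM
      _ = ⨆ i, μ {ω | HasOscillations (fun t => x 0 t ω) (M i) ((V / V)⁻¹ * (V / V)) n a} :=
          Directed.measure_iUnion (Monotone.directed_le fun i j hij ω hω => hω.mono_set (hM hij))
      _ ≤ 2⁻¹ ^ n := by
          refine iSup_le fun i => ?_
          refine le_trans (measure_mono_ae ?_) (measure_manyExits_le hF hx (M := M i)
            (fun t ht => (hMS i t ht).2.2) hV (fun t ht => hVab t (hMS i t ht).2) n hab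
            (hVab a ⟨le_rfl, hab⟩))
          filter_upwards [hmul] with ω hω hosc
          have h1' : (1 : G) ∈ V / V := ⟨1, h1, 1, h1, div_one 1⟩
          refine mem_manyExits_of_hasOscillations h1' le_rfl ?_ hosc
          intro u hu v hv huv
          refine hω u ?_ v (hMS i v hv) huv
          rcases Finset.mem_insert.1 hu with rfl | hu
          · exact Set.mem_insert _ _
          · exact Set.mem_insert_of_mem _ (hMS i u hu)
  have hnull : μ {ω | ∀ n, HasOscillations (fun t => x 0 t ω) S ((V / V)⁻¹ * (V / V)) n a} = 0 := by
    refine le_antisymm (ge_of_tendsto'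
      (ENNReal.tendsto_pow_atTop_nhds_zero_of_lt_one (r := 2⁻¹) (by simp)) fun n => ?_) zero_le
    exact (measure_mono (Set.ofPred_subset_ofPred.2 fun ω hω => hω n)).trans (hbound n)
  rw [ae_iff]
  simpa only [not_exists, not_not] using hnull

/-- Stochastic continuity provides a countable cover of the time axis by intervals to which the
bound on the number of oscillations applies. -/
theorem ae_isLocallyRegulatedOn [FirstCountableTopology G] (hF : IsAdditiveFiltration μ F)
    (hx : IsMultiplicativeProcess μ F x) {D : Set ℝ≥0} (hD : D.Countable) :
    ∀ᵐ ω ∂μ, IsLocallyRegulatedOn (fun t => x 0 t ω) D := by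
  have key : ∀ U ∈ 𝓝 (1 : G), ∀ᵐ ω ∂μ, ∀ t : ℝ≥0, ∃ a b : ℝ≥0, Set.Icc a b ∈ 𝓝 t ∧
      ∃ n, ¬ HasOscillations (fun t => x 0 t ω) (D ∩ Set.Icc a b) U n a := by
    intro U hU
    -- `V` is chosen so small that `(V / V)⁻¹ * (V / V) ⊆ U`.
    obtain ⟨A, hAo, hA1, hAU⟩ := exists_open_nhds_one_mul_subset hU
    have hA := hAo.mem_nhds hA1
    obtain ⟨V', hV', hVA⟩ := exists_nhds_split_inv (inter_mem hA (inv_mem_nhds_one G hA))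
    obtain ⟨V, hVV', hV, h1⟩ := mem_nhds_iff.1 hV'
    have hsub : (V / V)⁻¹ * (V / V) ⊆ U := by
      have hdiv : V / V ⊆ A ∩ A⁻¹ := by
        rintro _ ⟨v, hv, w, hw, rfl⟩
        exact hVA v (hVV' hv) w (hVV' hw)
      refine (Set.mul_subset_mul ?_ (hdiv.trans Set.inter_subset_left)).trans hAU
      exact Set.inv_subset.2 (hdiv.trans Set.inter_subset_right)
    have hloc : ∀ t : ℝ≥0, ∃ a b : ℝ≥0, Set.Icc a b ∈ 𝓝 t ∧
        ∀ u ∈ Set.Icc a b, μ {ω | x u b ω ∉ V} ≤ 4⁻¹ := by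
      intro t
      have hev := (tendsto_measure_increment_notMem hF hx t hV h1).eventually
        (Iic_mem_nhds (show (0 : ℝ≥0∞) < 4⁻¹ by simp))
      obtain ⟨R, hR, hRV⟩ := mem_nhdsWithin_iff_exists_mem_nhds_inter.1 hev
      obtain ⟨N, hN, N', hN', hNN'⟩ := mem_nhds_prod_iff.1 hR
      obtain ⟨a, b, hmem, hab, hsubN⟩ := exists_Icc_mem_subset_of_mem_nhds (inter_mem hN hN')
      refine ⟨a, b, hab, fun u hu => ?_⟩
      exact hRV ⟨hNN' (Set.mk_mem_prod (hsubN hu).1 (hsubN ⟨hmem.1.trans hmem.2, le_rfl⟩).2), hu.2⟩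
    choose a b hab hVab using hloc
    obtain ⟨T, hT, hcover⟩ := countable_cover_nhds_interior hab
    have hae : ∀ᵐ ω ∂μ, ∀ t ∈ T, ∃ n, ¬ HasOscillations (fun t => x 0 t ω)
        (D ∩ Set.Icc (a t) (b t)) ((V / V)⁻¹ * (V / V)) n (a t) :=
      (ae_ball_iff hT).2 fun t _ => ae_exists_not_hasOscillations hF hx hD
        ((mem_of_mem_nhds (hab t)).1.trans (mem_of_mem_nhds (hab t)).2) hV h1 (hVab t)
    filter_upwards [hae] with ω hω t
    obtain ⟨t', ht', htt'⟩ := Set.mem_iUnion₂.1 (hcover.symm ▸ Set.mem_univ t)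
    obtain ⟨n, hn⟩ := hω t' ht'
    exact ⟨a t', b t', mem_interior_iff_mem_nhds.1 htt', n, fun h => hn (h.anti_size hsub)⟩
  obtain ⟨u, hu⟩ := (𝓝 (1 : G)).exists_antitone_basis
  filter_upwards [ae_all_iff.2 fun n => key (u n) (hu.mem n)] with ω hω U hU t
  obtain ⟨n, hn⟩ := hu.mem_iff.1 hU
  obtain ⟨a, b, hab, m, hm⟩ := hω n t
  exact ⟨a, b, hab, m, fun h => hm (h.anti_size hn)⟩

/-- The almost sure right limit at `t` agrees with the limit in probability, which is `x 0 t`. -/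
theorem ae_eq_of_tendsto_right [FirstCountableTopology G] [T1Space G]
    (hF : IsAdditiveFiltration μ F) (hx : IsMultiplicativeProcess μ F x) {D : Set ℝ≥0}
    (hD : Dense D) (hDc : D.Countable) {t : ℝ≥0} {Y : Ω → G}
    (hY : ∀ᵐ ω ∂μ, Tendsto (fun u => x 0 u ω) (𝓝[D ∩ Set.Ioi t] t) (𝓝 (Y ω))) :
    ∀ᵐ ω ∂μ, Y ω = x 0 t ω := by
  have := nhdsWithin_inter_Ioi_neBot hD t
  obtain ⟨d, hd⟩ := exists_seq_tendsto (𝓝[D ∩ Set.Ioi t] t)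
  have hdD : ∀ᶠ n in atTop, d n ∈ D ∩ Set.Ioi t := hd.eventually self_mem_nhdsWithin
  have hpair : Tendsto (fun n => (t, d n)) atTop (𝓝[{p : ℝ≥0 × ℝ≥0 | p.1 ≤ p.2}] (t, t)) := by
    refine tendsto_nhdsWithin_iff.2 ⟨tendsto_const_nhds.prodMk_nhds
      (tendsto_nhds_of_tendsto_nhdsWithin hd), ?_⟩
    filter_upwards [hdD] with n hn using le_of_lt hn.2
  have hlim : ∀ᵐ ω ∂μ, Tendsto (fun n => x t (d n) ω) atTop (𝓝 ((x 0 t ω)⁻¹ * Y ω)) := by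
    have hmul : ∀ᵐ ω ∂μ, ∀ u ∈ D, t ≤ u → x t u ω = (x 0 t ω)⁻¹ * x 0 u ω :=
      (ae_ball_iff hDc).2 fun u _ =>
        Filter.eventually_imp_distrib_left.2 fun htu => hx.ae_eq_inv_mul htu
    filter_upwards [hmul, hY] with ω hω hYω
    refine ((hYω.comp hd).const_mul (x 0 t ω)⁻¹).congr' ?_
    filter_upwards [hdD] with n hn
    exact (hω (d n) hn.1 (le_of_lt hn.2)).symm
  have key : ∀ V : Set G, IsOpen V → (1 : G) ∈ V →
      ∀ᵐ ω ∂μ, (x 0 t ω)⁻¹ * Y ω ∈ closure V := by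
    intro V hV h1
    have hsmall : Tendsto (fun n => μ {ω | x t (d n) ω ∉ V}) atTop (𝓝 0) :=
      (tendsto_measure_increment_notMem hF hx t hV h1).comp hpair
    have hfreq : ∀ᵐ ω ∂μ, ∀ m, ∃ n ≥ m, x t (d n) ω ∈ V := by
      refine ae_all_iff.2 fun m => ?_
      rw [ae_iff]
      refine le_antisymm (ge_of_tendsto hsmall ?_) zero_le
      filter_upwards [eventually_ge_atTop m] with n hn
      refine measure_mono fun ω hω hmem => hω ⟨n, hn, hmem⟩
    filter_upwards [hfreq, hlim] with ω hω hωlim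
    exact mem_closure_of_frequently_of_tendsto (frequently_atTop.2 hω) hωlim
  obtain ⟨u, hu⟩ := (𝓝 (1 : G)).exists_antitone_basis
  filter_upwards [ae_all_iff.2 fun n => key (interior (u n)) isOpen_interior
    (mem_interior_iff_mem_nhds.2 (hu.mem n))] with ω hω
  suffices h : (x 0 t ω)⁻¹ * Y ω = 1 from (inv_mul_eq_one.1 h).symm
  by_contra hne
  obtain ⟨C, ⟨hC, hCc⟩, hsub⟩ := (closed_nhds_basis (1 : G)).mem_iff.1
    (isOpen_compl_singleton.mem_nhds (Ne.symm hne))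
  obtain ⟨n, hn⟩ := hu.mem_iff.1 hC
  exact hsub (closure_minimal (interior_subset.trans hn) hCc (hω n)) rfl

/-- A stochastically continuous process with independent increments in a left complete group has
a càdlàg modification. -/
theorem exists_isCadlag_modification [FirstCountableTopology G] [T1Space G]
    (hG : IsLeftComplete G) (hF : IsAdditiveFiltration μ F)
    (hx : IsMultiplicativeProcess μ F x) :
    ∃ Y : ℝ≥0 → Ω → G, (∀ ω, IsCadlag fun t => Y t ω) ∧ ∀ t, ∀ᵐ ω ∂μ, Y t ω = x 0 t ω := by
  obtain ⟨D, hDc, hD⟩ := TopologicalSpace.exists_countable_dense ℝ≥0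
  have hpath : ∀ ω, ∃ g : ℝ≥0 → G, IsCadlag g ∧
      (IsLocallyRegulatedOn (fun t => x 0 t ω) D →
        ∀ t, Tendsto (fun u => x 0 u ω) (𝓝[D ∩ Set.Ioi t] t) (𝓝 (g t))) := by
    intro ω
    by_cases h : IsLocallyRegulatedOn (fun t => x 0 t ω) D
    · obtain ⟨g, hg, hlim⟩ := h.exists_isCadlag hG hD
      exact ⟨g, hg, fun _ => hlim⟩
    -- On the exceptional null set the path is replaced by a constant one.
    · exact ⟨fun _ => 1, ⟨fun _ => tendsto_const_nhds, fun _ => ⟨1, tendsto_const_nhds⟩⟩,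
        fun h' => absurd h' h⟩
  choose Y hY hlim using hpath
  refine ⟨fun t ω => Y ω t, hY, fun t => ae_eq_of_tendsto_right hF hx hD hDc ?_⟩
  filter_upwards [ae_isLocallyRegulatedOn hF hx hDc] with ω hω using hlim ω hω t

end Regularity

/-! ### Modifications of multiplicative processes -/

section Modification

variable {Ω : Type*} {G : Type*} {mΩ : MeasurableSpace Ω} {μ : Measure Ω}

theorem measurable_of_ae_eq_of_complete [MeasurableSpace G] {m : MeasurableSpace Ω}
    (hm : ∀ A : Set Ω, μ A = 0 → MeasurableSet[m] A) {f g : Ω → G} (hf : Measurable[m] f)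
    (hfg : ∀ᵐ ω ∂μ, g ω = f ω) : Measurable[m] g := by
  intro B hB
  have hN : μ {ω | g ω ≠ f ω} = 0 := ae_iff.1 hfg
  have heq : g ⁻¹' B = (f ⁻¹' B \ {ω | g ω ≠ f ω}) ∪ (g ⁻¹' B ∩ {ω | g ω ≠ f ω}) := by
    ext ω
    by_cases h : g ω = f ω <;> simp [h]
  rw [heq]
  exact ((hf hB).diff (hm _ hN)).union (hm _ (measure_mono_null Set.inter_subset_right hN))

theorem IsModification.isMultiplicativeProcess [Group G] [TopologicalSpace G] [MeasurableSpace G]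
    {F : ℝ≥0 → ℝ≥0 → MeasurableSpace Ω} {x y : ℝ≥0 → ℝ≥0 → Ω → G}
    (hF : IsAdditiveFiltration μ F) (hx : IsMultiplicativeProcess μ F x)
    (hyx : IsModification μ y x) : IsMultiplicativeProcess μ F y where
  adapted s t hst :=
    measurable_of_ae_eq_of_complete (hF.complete s t hst) (hx.adapted s t hst) (hyx s t hst)
  diag s := by
    filter_upwards [hyx s s le_rfl, hx.diag s] with ω h h'
    rw [h, h']
  mul s t u hst htu := by
    filter_upwards [hyx s t hst, hyx t u htu, hyx s u (hst.trans htu), hx.mul s t u hst htu]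
      with ω h h' h'' hmul
    rw [h, h', h'', hmul]
  stochCont s t hst U hU h1 := by
    refine (hx.stochCont s t hst U hU h1).congr' ?_
    filter_upwards [self_mem_nhdsWithin] with p hp
    refine measure_congr (eventuallyEq_set.2 ?_)
    filter_upwards [hyx s t hst, hyx p.1 p.2 hp] with ω h h'
    simp [h, h']

end Modification

/-- A charted space is as first countable as its model. -/
theorem firstCountableTopology_of_chartedSpace (H : Type*) [TopologicalSpace H]
    [FirstCountableTopology H] (M : Type*) [TopologicalSpace M] [ChartedSpace H M] :
    FirstCountableTopology M where
  nhds_generated_countable p := by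
    rw [← (chartAt H p).symm_map_nhds_eq (mem_chart_source H p)]
    infer_instance

end MultProc

theorem mainTheorem1
    {E : Type*} [NormedAddCommGroup E] [NormedSpace ℝ E] [CompleteSpace E]
    {G : Type*} [Group G] [TopologicalSpace G] [ChartedSpace E G] [LieGroup 𝓘(ℝ, E) ((⊤ : ℕ∞) : WithTop ℕ∞) G]
    [TopologicalSpace.SeparableSpace G] [MeasurableSpace G] [BorelSpace G]
    {Ω : Type*} [MeasurableSpace Ω] (μ : Measure Ω) [IsProbabilityMeasure μ] [μ.IsComplete]
    (F : ℝ≥0 → ℝ≥0 → MeasurableSpace Ω) (hF : MultProc.IsAdditiveFiltration μ F)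
    (x : ℝ≥0 → ℝ≥0 → Ω → G) (hx : MultProc.IsMultiplicativeProcess μ F x) :
    ∃ y : ℝ≥0 → ℝ≥0 → Ω → G,
      MultProc.IsModification μ y x ∧
      (∀ ω, MultProc.IsCadlagBoth (fun s t => y s t ω)) ∧
      MultProc.IsMultiplicativeProcess μ F y ∧
      ∀ ω, ∀ s t u : ℝ≥0, s ≤ t → t ≤ u →
        y s s ω = 1 ∧ y s u ω = y s t ω * y t u ω := by
  have : LieGroup 𝓘(ℝ, E) 1 G :=
    LieGroup.of_le (n := ((⊤ : ℕ∞) : WithTop ℕ∞)) (by exact_mod_cast le_top)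
  have : IsTopologicalGroup G := topologicalGroup_of_lieGroup 𝓘(ℝ, E) 1
  have : FirstCountableTopology G := MultProc.firstCountableTopology_of_chartedSpace E G
  have : T1Space G := ChartedSpace.t1Space E G
  obtain ⟨Y, hY, hYx⟩ := MultProc.exists_isCadlag_modification
    (MultProc.isLeftComplete_of_lieGroup E) hF hx
  have hmod : MultProc.IsModification μ (fun s t ω => (Y s ω)⁻¹ * Y t ω) x := by
    intro s t hst
    filter_upwards [hYx s, hYx t, hx.ae_eq_inv_mul hst] with ω hs ht hmul
    rw [hs, ht, hmul]
  exact ⟨fun s t ω => (Y s ω)⁻¹ * Y t ω, hmod, fun ω => (hY ω).isCadlagBoth,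
    hmod.isMultiplicativeProcess hF hx, fun ω s t u _ _ => ⟨by group, by group⟩⟩
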